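/- Let $n\in\mathbb N$ and $1\le p,q\le\infty$. \textbf{Weights.} A measurable function $v:(0,\infty)\to(0,\infty)$ is regularly varying of index $\alpha\in\mathbb R$ if $\lim_{t\to\infty}v(tx)/v(t)=x^\alpha$ for all $x>0$. Let $\mathcal W(\mathbb R)$ be the set of all functions $w_*:[0,\infty)\to\mathbb R$ such that: $w_*\in C^\infty(0,\infty)$ is regularly varying of some index in $[0,1)$; $w_*\ge 1$; $w_*$ is strictly increasing; $\lim_{t\to\infty}(w_*(t)-M\log t)=\infty$ for every $M\in\mathbb R$; $w_*'(0)=0$ (one-sided derivative); and there is a number $\tau\geq 0$ such that $w_*''(x)<0$ for all $x>\tau$. \textbf{Modulation spaces.} Let $\rho\in C^\infty(\mathbb R^n)$ take values in $[0,1]$, be supported in $[-1,1]^n$ and equal $1$ on $[-\frac12,\frac12]^n$. For $k\in\mathbb Z^n$ put $\sigma_k(\xi)=\rho(\xi-k)\big/\sum_{l\in\mathbb Z^n}\rho(\xi-l)$ and $\Box_k f=\mathcal F^{-1}(\sigma_k\mathcal F f)$ for tempered distributions $f$, where $\mathcal F f(\xi)=(2\pi)^{-n/2}\int_{\mathbb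 R^n} f(x)e^{-ix\cdot\xi}\,dx$. Then $\mathcal M^{w_*}_{p,q}(\mathbb R^n)$ is the set of all complex-valued $f\in L^p(\mathbb R^n)$ with $$\Big(\sum_{k\in\mathbb Z^n}e^{q\,w_*(|k|)}\|\Box_k f\|_{L^p}^q\Big)^{1/q}<\infty$$ (with the supremum $\sup_k e^{w_*(|k|)}\|\Box_kf\|_{L^p}$ if $q=\infty$); here $|k|$ is the Euclidean norm. \textbf{Carleman classes.} For a multi-index $\beta\in\mathbb N_0^n$ let $|\beta|=\beta_1+\dots+\beta_n$ and $D^\beta=i^{-|\beta|}\partial^\beta$. For a sequence $(M_m)_{m\in\mathbb N_0}$ of positive numbers, $\mathcal E_{\{M_m\}}(\mathbb R^n)$ is the set of all $f\in C^\infty(\mathbb R^n)$ such that for every compact $K\subset\mathbb R^n$ there is $h>0$ with $\sup_{x\in K,\ \beta\in\mathbb N_0^n}\dfrac{|D^\beta f(x)|}{h^{|\beta|}M_{|\beta|}}<\infty$. \textbf{Proposition.} Let $w_*\in\mathcal W(\mathbb R)$ be regularly varying of index $\alpha$ with $0<\alpha<1$, and let $$M_m:=\sup_{r>0}\frac{r^m}{e^{w_*(r)}},\qquad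 m\in\mathbb N_0,$$ be its associated sequence. Then every $M_m$ is finite, and every $f\in\mathcal M^{w_*}_{p,q}(\mathbb R^n)$ is (after modification on a null set) infinitely often differentiable and there is a constant $C>0$, which may depend on $f$, such that $$|D^\beta f(x)|\le C^{|\beta|+1}M_{|\beta|}\qquad\text{for all }\beta\in\mathbb N_0^n,\ x\in\mathbb R^n .$$ Moreover, $f\in\mathcal E_{\{M_m\}}(\mathbb R^n)$. -/

import Mathlib

open MeasureTheory Set Filter Topology
open scoped ENNReal ContDiff SchwartzMap

noncomputable section

/-! ### Multi-index derivatives -/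

/-- The length `|α| = α₁ + ⋯ + αₙ` of a multi-index. -/
def multiLength {n : ℕ} (α : Fin n → ℕ) : ℕ := ∑ j, α j

/-- The partial derivative `∂f/∂xⱼ`. -/
def partialDeriv {n : ℕ} (j : Fin n) (f : EuclideanSpace ℝ (Fin n) → ℂ) :
    EuclideanSpace ℝ (Fin n) → ℂ :=
  fun x => lineDeriv ℝ f x (EuclideanSpace.single j 1)

/-- The derivative `∂^α f = ∂₁^α₁ (∂₂^α₂ (⋯ (∂ₙ^αₙ f)))`. -/
def multiPartial {n : ℕ} (α : Fin n → ℕ) (f : EuclideanSpace ℝ (Fin n) → ℂ) :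
    EuclideanSpace ℝ (Fin n) → ℂ :=
  (List.finRange n).foldr (fun j g => (partialDeriv j)^[α j] g) f

/-- `D^α f = i^{-|α|} ∂^α f`. -/
def multiD {n : ℕ} (α : Fin n → ℕ) (f : EuclideanSpace ℝ (Fin n) → ℂ) :
    EuclideanSpace ℝ (Fin n) → ℂ :=
  fun x => (1 / Complex.I ^ multiLength α) * multiPartial α f x

/-! ### Uniform decomposition and the operators `□ₖ` -/

/-- A lattice point of `ℤⁿ` seen in `ℝⁿ` (with the Euclidean norm). -/
def latticePt {n : ℕ} (k : Fin n → ℤ) : EuclideanSpace ℝ (Fin n) :=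
  WithLp.toLp 2 fun i => (k i : ℝ)

/-- Admissible windows: smooth `ρ : ℝⁿ → [0,1]` supported in the cube `[-1,1]ⁿ`, with `ρ = 1` on
`[-1/2,1/2]ⁿ`. -/
structure IsWindow {n : ℕ} (ρ : EuclideanSpace ℝ (Fin n) → ℝ) : Prop where
  contDiff : ContDiff ℝ ∞ ρ
  mem_Icc : ∀ ξ, ρ ξ ∈ Icc (0 : ℝ) 1
  tsupport_subset : tsupport ρ ⊆ {ξ | ∀ i, |ξ i| ≤ 1}
  eq_one : ∀ ξ, (∀ i, |ξ i| ≤ 1 / 2) → ρ ξ = 1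

/-- `σₖ(ξ) = ρ(ξ - k) / ∑ₗ ρ(ξ - l)`. For a window the sum has finitely many nonzero terms at each
point and is at least `1`. -/
def sigma {n : ℕ} (ρ : EuclideanSpace ℝ (Fin n) → ℝ) (k : Fin n → ℤ)
    (ξ : EuclideanSpace ℝ (Fin n)) : ℝ :=
  ρ (ξ - latticePt k) / ∑' l : Fin n → ℤ, ρ (ξ - latticePt l)

/-- The uniform decomposition operator `□ₖ T = F⁻¹ (σₖ F T)` on tempered distributions, where
`F f(ξ) = (2π)^{-n/2} ∫ f(x) e^{-i x·ξ} dx`. Mathlib's transform is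
`𝓕 f(η) = ∫ f(x) e^{-2π i x·η} dx`, so `F f(ξ) = (2π)^{-n/2} 𝓕 f(ξ / 2π)`, and the multiplier
`σₖ(ξ)` for `F` is the multiplier `η ↦ σₖ(2π η)` for `𝓕`. -/
def boxOp {n : ℕ} (ρ : EuclideanSpace ℝ (Fin n) → ℝ) (k : Fin n → ℤ)
    (T : 𝓢'(EuclideanSpace ℝ (Fin n), ℂ)) : 𝓢'(EuclideanSpace ℝ (Fin n), ℂ) :=
  TemperedDistribution.fourierMultiplierCLM ℂ
    (fun η => ((sigma ρ k ((2 * Real.pi) • η) : ℝ) : ℂ)) T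

/-- The `Lᵖ` norm of a tempered distribution: the norm of the (unique) `Lᵖ` function that
represents it, and `∞` if there is none. -/
def distLpNorm {n : ℕ} (p : ℝ≥0∞) [Fact (1 ≤ p)] (T : 𝓢'(EuclideanSpace ℝ (Fin n), ℂ)) : ℝ≥0∞ :=
  ⨅ (g : Lp ℂ p (volume : Measure (EuclideanSpace ℝ (Fin n))))
    (_ : Lp.toTemperedDistribution g = T), ‖g‖ₑ

/-! ### Modulation spaces -/

/-- The norm `(∑ₖ e^{q w(|k|)} ‖□ₖ f‖_{Lᵖ}^q)^{1/q}`, with the supremum over `k` if `q = ∞`. -/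
def modNorm {n : ℕ} (ρ : EuclideanSpace ℝ (Fin n) → ℝ) (w : ℝ → ℝ) (p q : ℝ≥0∞) [Fact (1 ≤ p)]
    (f : Lp ℂ p (volume : Measure (EuclideanSpace ℝ (Fin n)))) : ℝ≥0∞ :=
  if q = ⊤ then
    ⨆ k : Fin n → ℤ, ENNReal.ofReal (Real.exp (w ‖latticePt k‖)) *
      distLpNorm p (boxOp ρ k (Lp.toTemperedDistribution f))
  else
    (∑' k : Fin n → ℤ, (ENNReal.ofReal (Real.exp (w ‖latticePt k‖)) *
      distLpNorm p (boxOp ρ k (Lp.toTemperedDistribution f))) ^ q.toReal) ^ (1 / q.toReal)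

/-- The modulation space `𝓜^w_{p,q}(ℝⁿ)`. -/
def modSpace {n : ℕ} (ρ : EuclideanSpace ℝ (Fin n) → ℝ) (w : ℝ → ℝ) (p q : ℝ≥0∞) [Fact (1 ≤ p)] :
    Set (Lp ℂ p (volume : Measure (EuclideanSpace ℝ (Fin n)))) :=
  {f | modNorm ρ w p q f < ⊤}

/-! ### Weight functions -/

/-- `f : (0,∞) → (0,∞)` is measurable and regularly varying of index `α`. -/
structure IsRegularlyVarying (f : ℝ → ℝ) (α : ℝ) : Prop where
  pos : ∀ t, 0 < t → 0 < f t
  measurable : Measurable fun t : Ioi (0 : ℝ) => f t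
  tendsto : ∀ x, 0 < x → Tendsto (fun t => f (t * x) / f t) atTop (𝓝 (x ^ α))

/-- The class `𝒲(ℝ)` of weight functions `w : [0,∞) → ℝ` (values at negative arguments play no
role). -/
structure IsAdmissibleWeight (w : ℝ → ℝ) : Prop where
  smooth : ContDiffOn ℝ ∞ w (Ioi 0)
  regular : ∃ α : ℝ, 0 ≤ α ∧ α < 1 ∧ IsRegularlyVarying w α
  one_le : ∀ t, 0 ≤ t → 1 ≤ w t
  strictMono : StrictMonoOn w (Ici 0)
  superlog : ∀ M : ℝ, Tendsto (fun t => w t - M * Real.log t) atTop atTop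
  deriv_zero : HasDerivWithinAt w 0 (Ici 0) 0
  concave : ∃ τ : ℝ, 0 ≤ τ ∧ ∀ x, τ < x → deriv (deriv w) x < 0

/-! ### Carleman classes -/

/-- The associated sequence `M_m = sup_{r > 0} r^m / e^{w(r)}`. -/
def assocSeq (w : ℝ → ℝ) (m : ℕ) : ℝ :=
  ⨆ r : Ioi (0 : ℝ), (r : ℝ) ^ m / Real.exp (w r)

/-- The Carleman class of Roumieu type `𝓔_{M}(ℝⁿ)`: smooth functions such that on each compact
set `|D^α f| ≤ A h^{|α|} M_{|α|}` for all `α`, with some `h > 0` and some finite `A`. -/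
def carlemanClass (n : ℕ) (M : ℕ → ℝ) : Set (EuclideanSpace ℝ (Fin n) → ℂ) :=
  {f | ContDiff ℝ ∞ f ∧ ∀ K : Set (EuclideanSpace ℝ (Fin n)), IsCompact K →
    ∃ h : ℝ, 0 < h ∧ ∃ A : ℝ, ∀ x ∈ K, ∀ α : Fin n → ℕ,
      ‖multiD α f x‖ ≤ A * (h ^ multiLength α * M (multiLength α))}

end

/-! ### Weights and their associated sequences -/

/-! Each piece `□ₖ f` has its spectrum in a ball of fixed radius around a multiple of `k`, so it
equals its convolution with a Schwartz kernel, and the kernels for different `k` are modulations of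
a single one. Hölder's inequality bounds the piece in the supremum norm by its `Lᵖ` norm, uniformly
in `k`, and Bernstein's inequality (`contDiff_and_norm_iteratedFDeriv_le_of_reproducing`) costs a
factor `(A (1 + |k|))^m` for `m` derivatives. Membership in the modulation space gives `‖□ₖ f‖_p ≤ B
e^{-w(|k|)}`.

It remains to sum `(1 + |k|)^m e^{-w(|k|)}`. Bounding each term by `M_m` would leave nothing
summable. Since the index is positive, there is `x > 0` with `w(xt) ≤ w(t)/2` for large `t`; hence
`t^m e^{-w(t)} ≤ x^{-m} M_m e^{w(xt) - w(t)} ≤ x^{-m} M_m e^{-w(t)/2}`, and `e^{-w(|k|)/2}` is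
summable because `w` outgrows every multiple of the logarithm (`exists_pow_mul_exp_neg_le`,
`summable_exp_neg_half`).

The smooth sum of the pieces is `f` itself (`IsWindow.ae_eq_tsum`): a test function with compactly
supported inverse Fourier transform meets only finitely many symbols, and such functions are dense
in the Schwartz space. -/

theorem IsAdmissibleWeight.eventually_pow_le_exp {w : ℝ → ℝ} (hw : IsAdmissibleWeight w) (m : ℕ) :
    ∀ᶠ t in atTop, t ^ m ≤ Real.exp (w t) := by
  filter_upwards [(hw.superlog m).eventually_ge_atTop 0, eventually_gt_atTop 0] with t ht h0
  calc t ^ m = Real.exp (m * Real.log t) := by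
        rw [mul_comm, Real.exp_mul, Real.exp_log h0, Real.rpow_natCast]
    _ ≤ _ := Real.exp_le_exp.2 (by linarith)

theorem IsAdmissibleWeight.bddAbove_range {w : ℝ → ℝ} (hw : IsAdmissibleWeight w) (m : ℕ) :
    BddAbove (Set.range fun r : Ioi (0 : ℝ) => (r : ℝ) ^ m / Real.exp (w r)) := by
  obtain ⟨R, hR⟩ := eventually_atTop.1 (hw.eventually_pow_le_exp m)
  refine ⟨max 1 (|R| ^ m), ?_⟩
  rintro _ ⟨⟨r, hr⟩, rfl⟩
  have hr : 0 < r := hr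
  simp only
  rw [div_le_iff₀ (Real.exp_pos _)]
  rcases le_total R r with h | h
  · calc r ^ m ≤ 1 * Real.exp (w r) := by simpa using hR r h
      _ ≤ _ := by gcongr; exact le_max_left _ _
  · have h1 : r ^ m ≤ |R| ^ m := by gcongr; exact h.trans (le_abs_self R)
    have h2 : (1 : ℝ) ≤ Real.exp (w r) := Real.one_le_exp (by linarith [hw.one_le r hr.le])
    calc r ^ m = r ^ m * 1 := (mul_one _).symm
      _ ≤ max 1 (|R| ^ m) * Real.exp (w r) := by
        gcongr
        exact h1.trans (le_max_right _ _)

theorem IsAdmissibleWeight.le_assocSeq {w : ℝ → ℝ} (hw : IsAdmissibleWeight w) (m : ℕ) {r : ℝ}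
    (hr : 0 < r) : r ^ m / Real.exp (w r) ≤ assocSeq w m :=
  le_ciSup (hw.bddAbove_range m) (⟨r, hr⟩ : Ioi (0 : ℝ))

theorem IsAdmissibleWeight.assocSeq_pos {w : ℝ → ℝ} (hw : IsAdmissibleWeight w) (m : ℕ) :
    0 < assocSeq w m :=
  lt_of_lt_of_le (by positivity) (hw.le_assocSeq m one_pos)

/-- Regular variation of positive index allows half of the weight to be split off. -/
theorem IsAdmissibleWeight.exists_pow_mul_exp_neg_le {w : ℝ → ℝ} (hw : IsAdmissibleWeight w)
    {a : ℝ} (ha : 0 < a) (hwa : IsRegularlyVarying w a) :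
    ∃ C : ℝ, 1 ≤ C ∧ ∀ t, 0 ≤ t → ∀ m : ℕ,
      (1 + t) ^ m * Real.exp (-w t) ≤ C ^ (m + 1) * assocSeq w m * Real.exp (-(w t / 2)) := by
  -- With `x ^ a = 1/4`, the ratio `w (t * x) / w t` tends to `1/4`, so it is eventually below
  -- `1/2`.
  set x : ℝ := (1 / 4 : ℝ) ^ (1 / a) with hx
  have hx0 : 0 < x := by positivity
  have hxa : x ^ a = 1 / 4 := by
    rw [hx, ← Real.rpow_mul (by norm_num), one_div_mul_cancel ha.ne', Real.rpow_one]
  have hlim := hwa.tendsto x hx0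
  rw [hxa] at hlim
  obtain ⟨t₀, ht₀⟩ := eventually_atTop.1
    (hlim.eventually_lt_const (show (1 / 4 : ℝ) < 1 / 2 by norm_num))
  set s := max t₀ 1 with hs
  have hs1 : 1 ≤ s := le_max_right _ _
  refine ⟨max (2 / x) (max (1 + s) (Real.exp (w 1))), ?_, fun t ht m => ?_⟩
  · exact le_max_of_le_right (le_max_of_le_left (by linarith))
  set C := max (2 / x) (max (1 + s) (Real.exp (w 1))) with hC
  have hC1 : 2 / x ≤ C := le_max_left _ _
  have hC2 : 1 + s ≤ C := (le_max_left _ _).trans (le_max_right _ _)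
  have hC3 : Real.exp (w 1) ≤ C := (le_max_right _ _).trans (le_max_right _ _)
  have hC0 : 1 ≤ C := by linarith
  have hM := hw.assocSeq_pos m
  rcases le_total s t with h | h
  · have ht1 : 1 ≤ t := hs1.trans h
    have ht0 : 0 < t := by linarith
    have h1 : w (t * x) ≤ w t / 2 := by
      have := ht₀ t ((le_max_left _ _).trans h)
      rw [div_lt_iff₀ (hwa.pos t ht0)] at this
      linarith
    have h2 := hw.le_assocSeq m (mul_pos ht0 hx0)
    rw [div_le_iff₀ (Real.exp_pos _)] at h2
    have h3 : (1 + t) ^ m ≤ (2 / x) ^ m * (t * x) ^ m := by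
      rw [← mul_pow, show 2 / x * (t * x) = 2 * t by field_simp]
      gcongr
      linarith
    calc (1 + t) ^ m * Real.exp (-w t)
        ≤ (2 / x) ^ m * (assocSeq w m * Real.exp (w t / 2)) * Real.exp (-w t) := by
          gcongr
          refine h3.trans ?_
          gcongr
          refine h2.trans ?_
          gcongr
      _ = (2 / x) ^ m * assocSeq w m * Real.exp (-(w t / 2)) := by
          rw [mul_assoc, mul_assoc, ← Real.exp_add, mul_assoc]
          ring_nf
      _ ≤ C ^ (m + 1) * assocSeq w m * Real.exp (-(w t / 2)) := by
          gcongr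
          calc (2 / x) ^ m ≤ C ^ m := by gcongr
            _ ≤ C ^ (m + 1) := pow_le_pow_right₀ hC0 (Nat.le_succ m)
  -- On the bounded range `t ≤ s` the power is at most `C ^ m`. Taking `r = 1` in the supremum gives
  -- `assocSeq w m ≥ exp (-w 1)`, hence `assocSeq w m * C ≥ 1`.
  · have h2 := hw.le_assocSeq m one_pos
    rw [one_pow, div_le_iff₀ (Real.exp_pos _)] at h2
    have h4 : Real.exp (-w t) ≤ Real.exp (-(w t / 2)) :=
      Real.exp_le_exp.2 (by linarith [hw.one_le t ht])
    calc (1 + t) ^ m * Real.exp (-w t) ≤ C ^ m * Real.exp (-(w t / 2)) := by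
          gcongr
          linarith
      _ ≤ C ^ m * (assocSeq w m * C) * Real.exp (-(w t / 2)) := by
          gcongr
          refine le_mul_of_one_le_right (by positivity) (h2.trans ?_)
          gcongr
      _ = _ := by ring

/-! ### The integer lattice -/

section Lattice

variable {n : ℕ}

theorem latticePt_injective : Function.Injective (latticePt (n := n)) := by
  intro k l h
  ext i
  have := congrArg (fun v : EuclideanSpace ℝ (Fin n) => v i) h
  simpa [latticePt] using this

theorem summable_norm_latticePt_rpow {r : ℝ} (hr : r < -n) :
    Summable fun k : Fin n → ℤ => ‖latticePt k‖ ^ r := by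
  let b := (EuclideanSpace.basisFun (Fin n) ℝ).toBasis
  let Λ := Submodule.span ℤ (Set.range b)
  have hmem (k : Fin n → ℤ) : latticePt k ∈ Λ := by
    have : latticePt k = ∑ i, k i • b i := by
      ext j
      simp [latticePt, b, Finset.sum_apply, Pi.single_apply]
    rw [this]
    exact Submodule.sum_mem _ fun i _ => Submodule.smul_mem _ _ (Submodule.subset_span ⟨i, rfl⟩)
  have hrank : Module.finrank ℤ Λ = n := by
    rw [ZLattice.rank ℝ Λ]
    simp
  have h := ZLattice.summable_norm_rpow Λ r (by rwa [hrank])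
  exact h.comp_injective (i := fun k => (⟨latticePt k, hmem k⟩ : Λ)) fun k l hkl =>
    latticePt_injective (congrArg Subtype.val hkl)

theorem finite_norm_latticePt_le (r : ℝ) : {k : Fin n → ℤ | ‖latticePt k‖ ≤ r}.Finite := by
  refine (Set.Finite.pi' fun _ : Fin n => Set.finite_Icc (-⌈r⌉) ⌈r⌉).subset fun k hk i => ?_
  have h1 : |(k i : ℝ)| ≤ r := by
    have := (PiLp.norm_apply_le (latticePt k) i).trans hk
    simpa [latticePt] using this
  obtain ⟨h2, h3⟩ := abs_le.1 (h1.trans (Int.le_ceil r))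
  exact ⟨by exact_mod_cast h2, by exact_mod_cast h3⟩

theorem IsAdmissibleWeight.summable_exp_neg_half {w : ℝ → ℝ} (hw : IsAdmissibleWeight w) :
    Summable fun k : Fin n → ℤ => Real.exp (-(w ‖latticePt k‖ / 2)) := by
  -- The multiple `2 (n + 1)` of the logarithm makes half the weight beat `|k|^(n+1)`, just above
  -- the critical exponent `n` of the lattice.
  obtain ⟨R, hR⟩ := eventually_atTop.1 (((hw.superlog (2 * (n + 1))).eventually_ge_atTop 0).and
    (eventually_gt_atTop 0))
  refine Summable.of_norm_bounded_eventually
    (summable_norm_latticePt_rpow (n := n) (r := -(n + 1)) (by linarith)) ?_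
  refine (finite_norm_latticePt_le (n := n) R).subset fun k hk => ?_
  by_contra hkR
  obtain ⟨h1, h2⟩ := hR _ (not_le.1 hkR).le
  refine hk ?_
  change ‖_‖ ≤ _
  rw [Real.norm_eq_abs, Real.abs_exp, Real.rpow_def_of_pos h2]
  exact Real.exp_le_exp.2 (by linarith)

end Lattice

/-! ### Functions reproduced by a Schwartz kernel -/

section SmulRight

variable {E F : Type*} [NormedAddCommGroup E] [NormedSpace ℝ E] [NormedAddCommGroup F]
  [NormedSpace ℂ F]

theorem norm_smulRight_le_of_complex (c : E →L[ℝ] ℂ) (v : F) : ‖c.smulRight v‖ ≤ ‖c‖ * ‖v‖ := by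
  refine ContinuousLinearMap.opNorm_le_bound _ (by positivity) fun x => ?_
  rw [ContinuousLinearMap.smulRight_apply, norm_smul]
  calc _ ≤ ‖c‖ * ‖x‖ * ‖v‖ := by gcongr; exact c.le_opNorm x
    _ = _ := by ring

/-- Bilinear map `(c, v) ↦ c ⊗ v`. -/
noncomputable def smulRightL : (E →L[ℝ] ℂ) →L[ℝ] F →L[ℝ] (E →L[ℝ] F) :=
  LinearMap.mkContinuous₂ (LinearMap.mk₂ ℝ (fun c v => c.smulRight v)
    (fun _ _ _ => by ext; simp [add_smul]) (fun r c v => by ext x; exact smul_assoc r (c x) v)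
    (fun _ _ _ => by ext; simp)
    (fun r c v => by ext x; exact smul_comm (c x) r v)) 1
    fun c v => by simpa using norm_smulRight_le_of_complex c v

end SmulRight

section Kernel

universe u

variable {E V : Type u} [NormedAddCommGroup E] [InnerProductSpace ℝ E] [FiniteDimensional ℝ E]
  [MeasurableSpace E] [BorelSpace E] [NormedAddCommGroup V] [NormedSpace ℝ V]

/-- Supplies the dominating function, uniform over unit balls, for differentiating a convolution
under the integral. A shift by at most `1` changes `1 + ‖z‖` by at most a factor `2`. -/
theorem SchwartzMap.exists_integrable_bound_add (φ : 𝓢(E, V)) :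
    ∃ b : E → ℝ, Integrable b ∧ ∀ z h, ‖h‖ ≤ 1 → ‖φ (z + h)‖ ≤ b z := by
  set N := Module.finrank ℝ E + 1 with hN
  obtain ⟨C, hC0, hC⟩ : ∃ C : ℝ, 0 ≤ C ∧ ∀ x, (1 + ‖x‖) ^ N * ‖φ x‖ ≤ C := by
    have h (x : E) := SchwartzMap.one_add_le_sup_seminorm_apply (𝕜 := ℝ) (m := (N, 0))
      le_rfl le_rfl φ x
    simp only [norm_iteratedFDeriv_zero] at h
    exact ⟨_, (by positivity : (0 : ℝ) ≤ _).trans (h 0), h⟩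
  refine ⟨fun z => C * 2 ^ N * (1 + ‖z‖) ^ (-(N : ℝ)),
    (integrable_one_add_norm (by rw [hN]; push_cast; linarith)).const_mul _, fun z h hh => ?_⟩
  have h1 : 1 + ‖z‖ ≤ 2 * (1 + ‖z + h‖) := by
    have := norm_sub_le (z + h) h
    rw [add_sub_cancel_right] at this
    linarith [norm_nonneg (z + h)]
  beta_reduce
  rw [Real.rpow_neg (by positivity), Real.rpow_natCast, ← div_eq_mul_inv,
    le_div_iff₀ (by positivity)]
  calc ‖φ (z + h)‖ * (1 + ‖z‖) ^ N ≤ ‖φ (z + h)‖ * (2 * (1 + ‖z + h‖)) ^ N := by gcongr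
    _ = (1 + ‖z + h‖) ^ N * ‖φ (z + h)‖ * 2 ^ N := by rw [mul_pow]; ring
    _ ≤ C * 2 ^ N := by gcongr; exact hC _

variable {F : Type u} [NormedAddCommGroup F] [NormedSpace ℂ F]

variable {φ : 𝓢(E, ℂ)} {u : E → F} {B : ℝ}

/-- Initially `u` is only measurable and bounded, so the derivative has to fall on the kernel. -/
theorem hasFDerivAt_of_reproducing [CompleteSpace F] (hu : AEStronglyMeasurable u volume)
    (hB : ∀ x, ‖u x‖ ≤ B) (hrep : ∀ x, u x = ∫ y, φ (x - y) • u y) (x : E) :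
    HasFDerivAt u (∫ y, (fderiv ℝ φ (x - y)).smulRight (u y)) x := by
  obtain ⟨b, hb, hbφ⟩ := (SchwartzMap.fderivCLM ℝ E ℂ φ).exists_integrable_bound_add
  have hB0 : 0 ≤ B := (norm_nonneg _).trans (hB 0)
  have hint (x : E) : Integrable fun y => φ (x - y) • u y :=
    (φ.integrable.comp_sub_left x).smul_bdd B hu (.of_forall hB)
  have key := hasFDerivAt_integral_of_dominated_of_fderiv_le (𝕜 := ℝ) (μ := (volume : Measure E))
    (F := fun x y => φ (x - y) • u y) (F' := fun x y => (fderiv ℝ φ (x - y)).smulRight (u y))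
    (x₀ := x) (s := Metric.closedBall x 1) (bound := fun y => b (x - y) * B)
    (Metric.closedBall_mem_nhds x one_pos)
    (.of_forall fun x => (hint x).aestronglyMeasurable) (hint x) ?_ ?_
    ((hb.comp_sub_left x).mul_const B) ?_
  · exact key.congr_of_eventuallyEq (.of_forall hrep)
  · have hc : Continuous fun y => fderiv ℝ φ (x - y) := by
      exact (SchwartzMap.fderivCLM ℝ E ℂ φ).continuous.comp
        (continuous_const.sub continuous_id)
    exact smulRightL.aestronglyMeasurable_comp₂ hc.aestronglyMeasurable hu
  · refine .of_forall fun y x' hx' => (norm_smulRight_le_of_complex _ _).trans ?_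
    have := hbφ (x - y) (x' - x) (by simpa [dist_eq_norm] using hx')
    rw [SchwartzMap.fderivCLM_apply, show x - y + (x' - x) = x' - y by abel] at this
    gcongr
    · exact (norm_nonneg _).trans this
    · exact hB y
  · refine .of_forall fun y x' _ => ?_
    have := (φ.hasFDerivAt (x' - y)).comp x' ((hasFDerivAt_id x').sub_const y)
    simpa using this.smul_const (u y)

theorem norm_fderiv_le_of_reproducing [CompleteSpace F] (hu : AEStronglyMeasurable u volume)
    (hB : ∀ x, ‖u x‖ ≤ B) (hrep : ∀ x, u x = ∫ y, φ (x - y) • u y) (x : E) :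
    ‖fderiv ℝ u x‖ ≤ (∫ y, ‖fderiv ℝ φ y‖) * B := by
  rw [(hasFDerivAt_of_reproducing hu hB hrep x).fderiv]
  rw [← integral_sub_left_eq_self (fun y => ‖fderiv ℝ φ y‖) volume x, ← integral_mul_const]
  refine norm_integral_le_of_norm_le ?_ (.of_forall fun y => ?_)
  · exact ((SchwartzMap.fderivCLM ℝ E ℂ φ).integrable.norm.comp_sub_left x).mul_const B
  · refine (norm_smulRight_le_of_complex _ _).trans ?_
    gcongr
    exact hB y

theorem continuous_fderiv_of_reproducing [CompleteSpace F] (hu : AEStronglyMeasurable u volume)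
    (hB : ∀ x, ‖u x‖ ≤ B) (hrep : ∀ x, u x = ∫ y, φ (x - y) • u y) :
    Continuous (fderiv ℝ u) := by
  have hcont : Continuous u := continuous_iff_continuousAt.2 fun x =>
    (hasFDerivAt_of_reproducing hu hB hrep x).continuousAt
  -- After the change of variables `x` enters only through `u`, which is now known to be continuous,
  -- and dominated convergence applies.
  have : fderiv ℝ u = fun x => ∫ y, (fderiv ℝ φ y).smulRight (u (x - y)) := by
    ext1 x
    rw [(hasFDerivAt_of_reproducing hu hB hrep x).fderiv,
      ← integral_sub_left_eq_self (fun y => (fderiv ℝ φ y).smulRight (u (x - y))) volume x]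
    simp
  rw [this]
  have hφ : Continuous (fderiv ℝ φ) := (SchwartzMap.fderivCLM ℝ E ℂ φ).continuous
  refine continuous_of_dominated (bound := fun y => ‖fderiv ℝ φ y‖ * B) (fun x => ?_)
    (fun x => .of_forall fun y => ?_) ?_ (.of_forall fun y => ?_)
  · exact (smulRightL.continuous₂.comp
      (hφ.prodMk (hcont.comp (by fun_prop : Continuous fun y => x - y)))).aestronglyMeasurable
  · refine (norm_smulRight_le_of_complex _ _).trans ?_
    gcongr
    exact hB _
  · exact (SchwartzMap.fderivCLM ℝ E ℂ φ).integrable.norm.mul_const B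
  · exact (smulRightL (fderiv ℝ φ y)).continuous.comp (hcont.comp (by fun_prop))

/-- Now that `u` is differentiable with bounded derivative, the derivative can fall on `u` instead.
The derivative is thus reproduced by the same kernel, which allows Bernstein's inequality to be
iterated. -/
theorem fderiv_reproducing [CompleteSpace F] (hu : AEStronglyMeasurable u volume)
    (hB : ∀ x, ‖u x‖ ≤ B) (hrep : ∀ x, u x = ∫ y, φ (x - y) • u y) (x : E) :
    fderiv ℝ u x = ∫ y, φ (x - y) • fderiv ℝ u y := by
  have hd (x : E) := (hasFDerivAt_of_reproducing hu hB hrep x).differentiableAt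
  have hcont : Continuous u := continuous_iff_continuousAt.2 fun x => (hd x).continuousAt
  have hcont' := continuous_fderiv_of_reproducing hu hB hrep
  set A := ∫ y, ‖fderiv ℝ φ y‖
  have hbd := norm_fderiv_le_of_reproducing hu hB hrep
  have hrep' : u = fun x => ∫ y, φ y • u (x - y) := by
    ext1 x
    rw [hrep x, ← integral_sub_left_eq_self (fun y => φ y • u (x - y)) volume x]
    simp
  have hm (x : E) : Continuous fun y => φ y • u (x - y) :=
    φ.continuous.smul (hcont.comp (by fun_prop))
  have key := hasFDerivAt_integral_of_dominated_of_fderiv_le (𝕜 := ℝ) (μ := (volume : Measure E))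
    (F := fun x y => φ y • u (x - y)) (F' := fun x y => φ y • fderiv ℝ u (x - y))
    (x₀ := x) (s := univ) (bound := fun y => ‖φ y‖ * (A * B)) univ_mem
    (.of_forall fun x => (hm x).aestronglyMeasurable) ?_ ?_ ?_ (φ.integrable.norm.mul_const _) ?_
  · rw [← hrep'] at key
    rw [key.fderiv, ← integral_sub_left_eq_self (fun y => φ y • fderiv ℝ u (x - y)) volume x]
    simp
  · exact φ.integrable.smul_bdd B
      (hcont.comp (by fun_prop : Continuous fun y => x - y)).aestronglyMeasurable
      (.of_forall fun y => hB _)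
  · exact (φ.continuous.smul (hcont'.comp (by fun_prop))).aestronglyMeasurable
  · refine .of_forall fun y x' _ => ?_
    rw [norm_smul]
    gcongr
    exact hbd _
  · refine .of_forall fun y x' _ => ?_
    have := (hd (x' - y)).hasFDerivAt.comp x' ((hasFDerivAt_id x').sub_const y)
    rw [ContinuousLinearMap.comp_id] at this
    exact this.const_smul (φ y)

/-- Bernstein's inequality for functions reproduced by a Schwartz kernel. -/
theorem contDiff_and_norm_iteratedFDeriv_le_of_reproducing (φ : 𝓢(E, ℂ)) (m : ℕ) :
    ∀ (F : Type u) [NormedAddCommGroup F] [NormedSpace ℂ F] [CompleteSpace F] (u : E → F) (B : ℝ),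
      AEStronglyMeasurable u volume → (∀ x, ‖u x‖ ≤ B) → (∀ x, u x = ∫ y, φ (x - y) • u y) →
      ContDiff ℝ m u ∧
        ∀ x, ‖iteratedFDeriv ℝ m u x‖ ≤ (∫ y, ‖fderiv ℝ φ y‖) ^ m * B := by
  induction m with
  | zero =>
    intro F _ _ _ u B hu hB hrep
    refine ⟨?_, fun x => by simpa using hB x⟩
    rw [Nat.cast_zero, contDiff_zero]
    exact continuous_iff_continuousAt.2 fun x =>
      (hasFDerivAt_of_reproducing hu hB hrep x).continuousAt
  | succ m ih =>
    intro F _ _ _ u B hu hB hrep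
    -- The induction changes the target space at each step, so `F` is quantified inside it and
    -- shares the universe of `E`.
    obtain ⟨h1, h2⟩ := ih (E →L[ℝ] F) (fderiv ℝ u) _
      (continuous_fderiv_of_reproducing hu hB hrep).aestronglyMeasurable
      (norm_fderiv_le_of_reproducing hu hB hrep) (fderiv_reproducing hu hB hrep)
    refine ⟨?_, fun x => ?_⟩
    · rw [Nat.cast_succ, contDiff_succ_iff_fderiv]
      exact ⟨fun x => (hasFDerivAt_of_reproducing hu hB hrep x).differentiableAt, by simp, h1⟩
    · rw [← norm_iteratedFDeriv_fderiv]
      exact (h2 x).trans_eq (by ring)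

end Kernel

/-! ### Convolution of `Lᵖ` functions with Schwartz kernels -/

section LpConvolution

open FourierTransform

universe u

variable {E : Type u} [NormedAddCommGroup E] [InnerProductSpace ℝ E] [FiniteDimensional ℝ E]
  [MeasurableSpace E] [BorelSpace E] {p : ℝ≥0∞} [hp : Fact (1 ≤ p)]

/-- Hölder's inequality; `(1 - p⁻¹)⁻¹` in `ℝ≥0∞` is the conjugate exponent, including the endpoints
`p = 1` and `p = ∞`. The bound is independent of `x` by translation invariance. -/
theorem eLpNorm_kernel_smul_le (K : 𝓢(E, ℂ)) (g : Lp ℂ p (volume : Measure E)) (x : E) :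
    eLpNorm (fun y => K (x - y) • g y) 1 volume ≤
      eLpNorm K (1 - p⁻¹)⁻¹ volume * eLpNorm g p volume := by
  have := ENNReal.HolderConjugate.inv_one_sub_inv' hp.out
  have : ENNReal.HolderConjugate (1 - p⁻¹)⁻¹ p := ENNReal.HolderConjugate.symm
  have hK : AEStronglyMeasurable (fun y => K (x - y)) volume :=
    (K.continuous.comp (by fun_prop : Continuous fun y => x - y)).aestronglyMeasurable
  refine (eLpNorm_smul_le_mul_eLpNorm (p := (1 - p⁻¹)⁻¹) (q := p)
    (Lp.aestronglyMeasurable g) hK).trans_eq ?_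
  congr 1
  exact eLpNorm_comp_measurePreserving (g := K) K.continuous.aestronglyMeasurable
    (Measure.measurePreserving_sub_left volume x)

theorem integrable_kernel_smul (K : 𝓢(E, ℂ)) (g : Lp ℂ p (volume : Measure E)) (x : E) :
    Integrable fun y => K (x - y) • g y := by
  rw [← memLp_one_iff_integrable]
  refine ⟨?_, (eLpNorm_kernel_smul_le K g x).trans_lt ?_⟩
  · exact (K.continuous.comp (by fun_prop : Continuous fun y => x - y)).aestronglyMeasurable.smul
      (Lp.aestronglyMeasurable g)
  · exact ENNReal.mul_lt_top (K.eLpNorm_lt_top _ _) (Lp.eLpNorm_lt_top g)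

theorem integral_norm_kernel_smul_le (K : 𝓢(E, ℂ)) (g : Lp ℂ p (volume : Measure E)) (x : E) :
    ∫ y, ‖K (x - y) • g y‖ ≤ (eLpNorm K (1 - p⁻¹)⁻¹ volume).toReal * ‖g‖ := by
  rw [integral_norm_eq_lintegral_enorm (integrable_kernel_smul K g x).aestronglyMeasurable,
    ← eLpNorm_one_eq_lintegral_enorm, Lp.norm_def, ← ENNReal.toReal_mul]
  exact ENNReal.toReal_mono (ENNReal.mul_lt_top (K.eLpNorm_lt_top _ _) (Lp.eLpNorm_lt_top g)).ne
    (eLpNorm_kernel_smul_le K g x)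

theorem norm_integral_kernel_smul_le (K : 𝓢(E, ℂ)) (g : Lp ℂ p (volume : Measure E)) (x : E) :
    ‖∫ y, K (x - y) • g y‖ ≤ (eLpNorm K (1 - p⁻¹)⁻¹ volume).toReal * ‖g‖ :=
  (norm_integral_le_integral_norm _).trans (integral_norm_kernel_smul_le K g x)

omit hp in
theorem aestronglyMeasurable_kernel_smul (K : 𝓢(E, ℂ)) (g : Lp ℂ p (volume : Measure E)) :
    AEStronglyMeasurable (fun z : E × E => K (z.1 - z.2) • g z.2) (volume.prod volume) :=
  (K.continuous.comp (by fun_prop : Continuous fun z : E × E => z.1 - z.2)).aestronglyMeasurable.smul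
    (Lp.aestronglyMeasurable g).comp_snd

omit hp in
theorem aestronglyMeasurable_integral_kernel_smul (K : 𝓢(E, ℂ))
    (g : Lp ℂ p (volume : Measure E)) :
    AEStronglyMeasurable (fun x => ∫ y, K (x - y) • g y) volume :=
  (aestronglyMeasurable_kernel_smul K g).integral_prod_right'

/-- Fubini's theorem moves the convolution from `g` onto the test function. -/
theorem integral_smul_integral_kernel_smul (K φ : 𝓢(E, ℂ)) (g : Lp ℂ p (volume : Measure E)) :
    ∫ x, φ x • ∫ y, K (x - y) • g y = ∫ y, (∫ x, K (x - y) * φ x) • g y := by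
  have hmeas : AEStronglyMeasurable (fun z : E × E => φ z.1 • K (z.1 - z.2) • g z.2)
      (volume.prod volume) :=
    φ.continuous.aestronglyMeasurable.comp_fst.smul (aestronglyMeasurable_kernel_smul K g)
  have hint : Integrable (fun z : E × E => φ z.1 • K (z.1 - z.2) • g z.2)
      (volume.prod volume) := by
    rw [integrable_prod_iff hmeas]
    refine ⟨.of_forall fun x => (integrable_kernel_smul K g x).smul (φ x), ?_⟩
    refine (φ.integrable.norm.mul_const
      ((eLpNorm K (1 - p⁻¹)⁻¹ volume).toReal * ‖g‖)).mono'
      hmeas.norm.integral_prod_right' (.of_forall fun x => ?_)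
    rw [Real.norm_of_nonneg (by positivity)]
    simp_rw [norm_smul (φ x)]
    rw [integral_const_mul]
    gcongr
    exact integral_norm_kernel_smul_le K g x
  simp_rw [← integral_smul]
  rw [integral_integral_swap hint]
  refine integral_congr_ae (.of_forall fun y => ?_)
  beta_reduce
  rw [← integral_smul_const]
  refine integral_congr_ae (.of_forall fun x => ?_)
  simp only [smul_eq_mul]
  ring

/-- This is the multiplier acting on test functions by duality. The convolution theorem turns the
product with `X` into a convolution, and two inverse transforms of `φ` give its reflection, hence
the kernel argument `x - y`. -/
theorem fourier_smulLeftCLM_fourierInv_apply (X φ : 𝓢(E, ℂ)) (y : E) :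
    𝓕 (SchwartzMap.smulLeftCLM ℂ X (𝓕⁻ φ)) y = ∫ x, (𝓕⁻ X) (x - y) * φ x := by
  have h1 : SchwartzMap.smulLeftCLM ℂ X (𝓕⁻ φ) =
      𝓕 (SchwartzMap.convolution (ContinuousLinearMap.mul ℂ ℂ) (𝓕⁻ X) (𝓕⁻ (𝓕⁻ φ))) := by
    rw [SchwartzMap.fourier_convolution]
    ext x
    simp [SchwartzMap.smulLeftCLM_apply_apply X.hasTemperateGrowth]
  have h2 (ψ : 𝓢(E, ℂ)) (z : E) : 𝓕 ψ z = 𝓕⁻ ψ (-z) := by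
    rw [SchwartzMap.fourier_coe, SchwartzMap.fourierInv_coe, Real.fourierInv_eq_fourier_neg,
      neg_neg]
  have h3 (z : E) : 𝓕⁻ (𝓕⁻ φ) z = φ (-z) := by
    have := h2 (𝓕⁻ φ) (-z)
    rw [neg_neg] at this
    rw [← this]
    simp
  rw [h1, h2, FourierTransform.fourierInv_fourier_eq, SchwartzMap.convolution_apply,
    convolution_def, ← integral_sub_right_eq_self _ y]
  refine integral_congr_ae (.of_forall fun x => ?_)
  simp [h3]

/-- An `Lᵖ` function fixed by a Fourier multiplier is the convolution with its kernel. -/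
theorem ae_eq_integral_kernel_smul_of_fourierMultiplierCLM_eq {X : 𝓢(E, ℂ)}
    {g : Lp ℂ p (volume : Measure E)}
    (h : TemperedDistribution.fourierMultiplierCLM ℂ X (Lp.toTemperedDistribution g) =
      Lp.toTemperedDistribution g) :
    g =ᵐ[volume] fun x => ∫ y, (𝓕⁻ X) (x - y) • g y := by
  refine ae_eq_of_integral_contDiff_smul_eq ((Lp.memLp g).locallyIntegrable hp.out) ?_ ?_
  · refine MemLp.locallyIntegrable (p := ⊤) ?_ le_top
    exact memLp_top_of_bound (aestronglyMeasurable_integral_kernel_smul _ g) _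
      (.of_forall fun x => norm_integral_kernel_smul_le _ g x)
  · intro φ hφ hφc
    have h1 : HasCompactSupport (Complex.ofRealCLM ∘ φ) := hφc.comp_left rfl
    have h2 : ContDiff ℝ ∞ (Complex.ofRealCLM ∘ φ) := by fun_prop
    set ψ : 𝓢(E, ℂ) := h1.toSchwartzMap h2 with hψ
    have h3 (z : ℂ) (x : E) : φ x • z = ψ x • z := by simp [hψ]
    simp_rw [h3]
    have h4 := DFunLike.congr_fun h ψ
    rw [TemperedDistribution.fourierMultiplierCLM_apply_apply, Lp.toTemperedDistribution_apply,
      Lp.toTemperedDistribution_apply] at h4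
    rw [← h4, integral_smul_integral_kernel_smul]
    simp_rw [fourier_smulLeftCLM_fourierInv_apply]

end LpConvolution

/-! ### Translated multipliers -/

section Modulation

open FourierTransform

universe u

variable {E : Type u} [NormedAddCommGroup E] [InnerProductSpace ℝ E] [FiniteDimensional ℝ E]
  [MeasurableSpace E] [BorelSpace E]

/-- Translating the symbol modulates the kernel by a unimodular factor, so kernel norms are the same
for all `k`. -/
theorem fourierInv_compSubConstCLM_apply (X : 𝓢(E, ℂ)) (a x : E) :
    𝓕⁻ (X.compSubConstCLM ℂ a) x = (Real.fourierChar (inner ℝ a x) : ℂ) * 𝓕⁻ X x := by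
  rw [SchwartzMap.fourierInv_coe, SchwartzMap.fourierInv_coe, Real.fourierInv_eq,
    Real.fourierInv_eq, ← integral_add_right_eq_self _ a, ← integral_const_mul]
  refine integral_congr_ae (.of_forall fun v => ?_)
  simp [inner_add_left, AddChar.map_add_eq_mul, Circle.smul_def]
  ring

variable {K L : 𝓢(E, ℂ)} {a : E}

omit [FiniteDimensional ℝ E] [MeasurableSpace E] [BorelSpace E] in
-- The product rule: differentiating the character contributes the factor `2π‖a‖`, the source of the
-- growth in `|k|` in Bernstein's inequality.
theorem norm_fderiv_le_of_modulation
    (h : ∀ x, L x = (Real.fourierChar (inner ℝ a x) : ℂ) * K x) (x : E) :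
    ‖fderiv ℝ L x‖ ≤ ‖fderiv ℝ K x‖ + 2 * Real.pi * ‖a‖ * ‖K x‖ := by
  have h1 : (L : E → ℂ) =
      fun x => Complex.exp (2 * Real.pi * Complex.I * (innerSL ℝ a x : ℝ)) * K x := by
    ext x
    rw [h, Real.fourierChar_apply]
    simp only [innerSL_apply_apply]
    push_cast
    ring_nf
  have h2 : HasFDerivAt (fun x => Complex.exp (2 * Real.pi * Complex.I * (innerSL ℝ a x : ℝ)))
      (Complex.exp (2 * Real.pi * Complex.I * (innerSL ℝ a x : ℝ)) •
        ((2 * Real.pi * Complex.I) • (Complex.ofRealCLM ∘L innerSL ℝ a))) x :=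
    (((Complex.ofRealCLM ∘L innerSL ℝ a).hasFDerivAt).const_mul (2 * Real.pi * Complex.I)).cexp
  have h3 : ‖Complex.exp (2 * Real.pi * Complex.I * (innerSL ℝ a x : ℝ))‖ = 1 := by
    rw [show (2 * Real.pi * Complex.I * (innerSL ℝ a x : ℝ) : ℂ) =
      ((2 * Real.pi * innerSL ℝ a x : ℝ) : ℂ) * Complex.I by push_cast; ring]
    exact Complex.norm_exp_ofReal_mul_I _
  have h4 : ‖Complex.ofRealCLM ∘L innerSL ℝ a‖ ≤ ‖a‖ := by
    refine (ContinuousLinearMap.opNorm_comp_le _ _).trans ?_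
    simp
  have h5 : ‖(2 * Real.pi * Complex.I : ℂ)‖ = 2 * Real.pi := by
    simp [abs_of_pos Real.pi_pos]
  have h6 := (h2.mul (K.hasFDerivAt x)).congr_of_eventuallyEq (f₁ := L)
    (.of_forall fun y => congrFun h1 y)
  rw [h6.fderiv]
  refine (norm_add_le _ _).trans ?_
  rw [norm_smul, norm_smul, norm_smul, norm_smul, h3, h5, one_mul, one_mul, mul_comm ‖K x‖]
  gcongr

theorem integral_norm_fderiv_le_of_modulation
    (h : ∀ x, L x = (Real.fourierChar (inner ℝ a x) : ℂ) * K x) :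
    ∫ x, ‖fderiv ℝ L x‖ ≤
      (∫ x, ‖fderiv ℝ K x‖) + 2 * Real.pi * ‖a‖ * ∫ x, ‖K x‖ := by
  have h1 := (SchwartzMap.fderivCLM ℝ E ℂ K).integrable (μ := volume).norm
  have h2 := (K.integrable (μ := volume).norm).const_mul (2 * Real.pi * ‖a‖)
  simp only [SchwartzMap.fderivCLM_apply] at h1
  rw [← integral_const_mul, ← integral_add h1 h2]
  exact integral_mono (SchwartzMap.fderivCLM ℝ E ℂ L).integrable.norm (h1.add h2)
    (norm_fderiv_le_of_modulation h)

theorem eLpNorm_eq_of_modulation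
    (h : ∀ x, L x = (Real.fourierChar (inner ℝ a x) : ℂ) * K x) (p : ℝ≥0∞) :
    eLpNorm L p volume = eLpNorm K p volume := by
  refine eLpNorm_congr_norm_ae (.of_forall fun x => ?_)
  rw [h, norm_mul, Circle.norm_coe, one_mul]

end Modulation

/-! ### The uniform decomposition -/

section Decomposition

variable {n : ℕ} {ρ : EuclideanSpace ℝ (Fin n) → ℝ}

theorem IsWindow.norm_le (hρ : IsWindow ρ) {ξ : EuclideanSpace ℝ (Fin n)} (h : ρ ξ ≠ 0) :
    ‖ξ‖ ≤ √n := by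
  have h1 : ∀ i, |ξ i| ≤ 1 := hρ.tsupport_subset (subset_tsupport ρ h)
  rw [EuclideanSpace.norm_eq]
  gcongr
  calc ∑ i, ‖ξ i‖ ^ 2 ≤ ∑ _i : Fin n, (1 : ℝ) :=
        Finset.sum_le_sum fun i _ => pow_le_one₀ (norm_nonneg _) (h1 i)
    _ = n := by simp

/-- The lattice points in a ball. -/
noncomputable def latticeBall (n : ℕ) (r : ℝ) : Finset (Fin n → ℤ) :=
  (finite_norm_latticePt_le r).toFinset

theorem mem_latticeBall {r : ℝ} {k : Fin n → ℤ} : k ∈ latticeBall n r ↔ ‖latticePt k‖ ≤ r := by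
  simp [latticeBall]

theorem IsWindow.eq_zero_of_notMem (hρ : IsWindow ρ) {r : ℝ} {ξ : EuclideanSpace ℝ (Fin n)}
    (hξ : ‖ξ‖ ≤ r) {k : Fin n → ℤ} (hk : k ∉ latticeBall n (r + √n)) :
    ρ (ξ - latticePt k) = 0 := by
  by_contra h
  refine hk (mem_latticeBall.2 ?_)
  have h1 := hρ.norm_le h
  have h2 := norm_sub_le ξ (ξ - latticePt k)
  rw [sub_sub_cancel] at h2
  linarith

theorem IsWindow.tsum_eq_sum (hρ : IsWindow ρ) {r : ℝ} {ξ : EuclideanSpace ℝ (Fin n)}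
    (hξ : ‖ξ‖ ≤ r) :
    ∑' l : Fin n → ℤ, ρ (ξ - latticePt l) =
      ∑ l ∈ latticeBall n (r + √n), ρ (ξ - latticePt l) :=
  _root_.tsum_eq_sum fun _ hk => hρ.eq_zero_of_notMem hξ hk

theorem IsWindow.one_le_tsum (hρ : IsWindow ρ) (ξ : EuclideanSpace ℝ (Fin n)) :
    1 ≤ ∑' l : Fin n → ℤ, ρ (ξ - latticePt l) := by
  rw [hρ.tsum_eq_sum le_rfl]
  -- Rounding each coordinate gives a lattice point whose translated window equals `1` at `ξ`.
  set k : Fin n → ℤ := fun i => round (ξ i)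
  have h1 : ρ (ξ - latticePt k) = 1 := hρ.eq_one _ fun i => by
    simpa [latticePt, k] using abs_sub_round (ξ i)
  have hk : k ∈ latticeBall n (‖ξ‖ + √n) := by
    by_contra hk
    rw [hρ.eq_zero_of_notMem le_rfl hk] at h1
    exact zero_ne_one h1
  rw [← h1]
  exact Finset.single_le_sum (f := fun l => ρ (ξ - latticePt l)) (fun l _ => (hρ.mem_Icc _).1) hk

theorem IsWindow.contDiff_tsum (hρ : IsWindow ρ) :
    ContDiff ℝ ∞ fun ξ => ∑' l : Fin n → ℤ, ρ (ξ - latticePt l) := by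
  rw [contDiff_iff_contDiffAt]
  intro ξ₀
  have h : ContDiff ℝ ∞ fun ξ => ∑ l ∈ latticeBall n (‖ξ₀‖ + 1 + √n), ρ (ξ - latticePt l) :=
    ContDiff.sum fun l _ => hρ.contDiff.comp (contDiff_id.sub contDiff_const)
  refine h.contDiffAt.congr_of_eventuallyEq ?_
  filter_upwards [(isOpen_lt continuous_norm continuous_const).mem_nhds
    (show ‖ξ₀‖ < ‖ξ₀‖ + 1 by linarith)] with ξ hξ
  exact hρ.tsum_eq_sum (le_of_lt hξ)

theorem IsWindow.contDiff_sigma (hρ : IsWindow ρ) (k : Fin n → ℤ) : ContDiff ℝ ∞ (sigma ρ k) :=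
  (hρ.contDiff.comp (contDiff_id.sub contDiff_const)).div hρ.contDiff_tsum fun ξ =>
    (zero_lt_one.trans_le (hρ.one_le_tsum ξ)).ne'

theorem IsWindow.sum_sigma (hρ : IsWindow ρ) {r : ℝ} {ξ : EuclideanSpace ℝ (Fin n)}
    (hξ : ‖ξ‖ ≤ r) : ∑ k ∈ latticeBall n (r + √n), sigma ρ k ξ = 1 := by
  simp only [sigma]
  rw [← Finset.sum_div, ← hρ.tsum_eq_sum hξ]
  exact div_self (zero_lt_one.trans_le (hρ.one_le_tsum ξ)).ne'

theorem IsWindow.sigma_eq_zero_of_notMem (hρ : IsWindow ρ) {r : ℝ}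
    {ξ : EuclideanSpace ℝ (Fin n)} (hξ : ‖ξ‖ ≤ r) {k : Fin n → ℤ}
    (hk : k ∉ latticeBall n (r + √n)) : sigma ρ k ξ = 0 := by
  rw [sigma, hρ.eq_zero_of_notMem hξ hk, zero_div]

/-- The multiplier of `□ₖ` with respect to the transform `𝓕`. -/
noncomputable def boxSymbol (ρ : EuclideanSpace ℝ (Fin n) → ℝ) (k : Fin n → ℤ)
    (η : EuclideanSpace ℝ (Fin n)) : ℂ :=
  ((sigma ρ k ((2 * Real.pi) • η) : ℝ) : ℂ)

theorem boxOp_eq (k : Fin n → ℤ) (T : 𝓢'(EuclideanSpace ℝ (Fin n), ℂ)) :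
    boxOp ρ k T = TemperedDistribution.fourierMultiplierCLM ℂ (boxSymbol ρ k) T := rfl

/-- The true radius is `√n / 2π`; the cruder `√n` suffices, since only a bound uniform in `k`
matters. -/
theorem IsWindow.norm_sub_le_of_boxSymbol_ne_zero (hρ : IsWindow ρ) {k : Fin n → ℤ}
    {η : EuclideanSpace ℝ (Fin n)} (h : boxSymbol ρ k η ≠ 0) :
    ‖η - (2 * Real.pi)⁻¹ • latticePt k‖ ≤ √n := by
  have h1 : ρ ((2 * Real.pi) • η - latticePt k) ≠ 0 := fun h0 => h (by
    rw [boxSymbol, sigma, h0, zero_div, Complex.ofReal_zero])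
  have hpi : 0 < 2 * Real.pi := by positivity
  have h2 : (2 * Real.pi) • η - latticePt k =
      (2 * Real.pi) • (η - (2 * Real.pi)⁻¹ • latticePt k) := by
    rw [smul_sub, smul_inv_smul₀ hpi.ne']
  have h3 := hρ.norm_le h1
  rw [h2, norm_smul, Real.norm_of_nonneg hpi.le] at h3
  refine (le_mul_of_one_le_left (norm_nonneg _) ?_).trans h3
  linarith [Real.pi_gt_three]

theorem IsWindow.contDiff_boxSymbol (hρ : IsWindow ρ) (k : Fin n → ℤ) :
    ContDiff ℝ ∞ (boxSymbol ρ k) :=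
  Complex.ofRealCLM.contDiff.comp ((hρ.contDiff_sigma k).comp (contDiff_const_smul _))

theorem IsWindow.hasTemperateGrowth_boxSymbol (hρ : IsWindow ρ) (k : Fin n → ℤ) :
    (boxSymbol ρ k).HasTemperateGrowth := by
  refine HasCompactSupport.hasTemperateGrowth ?_ (hρ.contDiff_boxSymbol k)
  refine HasCompactSupport.of_support_subset_isCompact
    (isCompact_closedBall ((2 * Real.pi)⁻¹ • latticePt k) √n) fun η hη => ?_
  rw [mem_closedBall_iff_norm]
  exact hρ.norm_sub_le_of_boxSymbol_ne_zero hη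

/-- A compactly supported Schwartz function is decomposed by finitely many of the symbols. -/
theorem IsWindow.exists_finset_smulLeftCLM (hρ : IsWindow ρ)
    {ψ : 𝓢(EuclideanSpace ℝ (Fin n), ℂ)} (hψ : HasCompactSupport ψ) :
    ∃ s : Finset (Fin n → ℤ), (∑ k ∈ s, SchwartzMap.smulLeftCLM ℂ (boxSymbol ρ k) ψ = ψ) ∧
      ∀ k ∉ s, SchwartzMap.smulLeftCLM ℂ (boxSymbol ρ k) ψ = 0 := by
  obtain ⟨r, hr⟩ := hψ.isBounded.exists_norm_le
  have hpi : 0 ≤ 2 * Real.pi := by positivity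
  have hr' {η : EuclideanSpace ℝ (Fin n)} (h : ψ η ≠ 0) :
      ‖(2 * Real.pi) • η‖ ≤ 2 * Real.pi * r := by
    rw [norm_smul, Real.norm_of_nonneg hpi]
    gcongr
    exact hr η (subset_tsupport ψ h)
  refine ⟨latticeBall n (2 * Real.pi * r + √n), ?_, fun k hk => ?_⟩
  · ext η
    rw [FunLike.coe_sum, Finset.sum_apply]
    simp_rw [SchwartzMap.smulLeftCLM_apply_apply (hρ.hasTemperateGrowth_boxSymbol _)]
    rw [← Finset.sum_smul]
    by_cases h : ψ η = 0
    · simp [h]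
    · simp only [boxSymbol]
      rw [← Complex.ofReal_sum, hρ.sum_sigma (hr' h), Complex.ofReal_one, one_smul]
  · ext η
    rw [SchwartzMap.smulLeftCLM_apply_apply (hρ.hasTemperateGrowth_boxSymbol _)]
    by_cases h : ψ η = 0
    · simp [h]
    · simp [boxSymbol, hρ.sigma_eq_zero_of_notMem (hr' h) hk]

end Decomposition

/-! ### Density of compactly supported functions in the Schwartz space -/

section Density

variable {E : Type*} [NormedAddCommGroup E] [InnerProductSpace ℝ E] [FiniteDimensional ℝ E]

/-- A smooth compactly supported function equal to `1` on a given ball. -/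
theorem exists_schwartzMap_eq_one_on_closedBall (r : ℝ) :
    ∃ χ : 𝓢(E, ℂ), HasCompactSupport χ ∧ ∀ x, ‖x‖ ≤ r → χ x = 1 := by
  let f : ContDiffBump (0 : E) := ⟨|r| + 1, |r| + 2, by positivity, by linarith⟩
  have h1 : HasCompactSupport (Complex.ofRealCLM ∘ f) := f.hasCompactSupport.comp_left rfl
  have h2 : ContDiff ℝ ∞ (Complex.ofRealCLM ∘ f) := Complex.ofRealCLM.contDiff.comp f.contDiff
  refine ⟨h1.toSchwartzMap h2, h1, fun x hx => ?_⟩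
  have : f x = 1 := f.one_of_mem_closedBall (by
    simp only [mem_closedBall_zero_iff, f]
    linarith [le_abs_self r])
  simp [this]

omit [FiniteDimensional ℝ E] in
-- The function `χ - 1` vanishes on the unit ball, and outside it a bounded quantity is at most a
-- multiple of `‖x‖`. Under dilation by `r` this linear bound yields the small factor `r`.
theorem exists_norm_iteratedFDeriv_sub_one_le {χ : 𝓢(E, ℂ)} (hχ : ∀ x, ‖x‖ ≤ 1 → χ x = 1)
    (i : ℕ) : ∃ C : ℝ, 0 ≤ C ∧ ∀ x, ‖iteratedFDeriv ℝ i (fun y => χ y - 1) x‖ ≤ C * ‖x‖ := by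
  set C := SchwartzMap.seminorm ℝ 0 i χ + 1
  have hC : 0 ≤ C := by positivity
  refine ⟨C, hC, fun x => ?_⟩
  rcases lt_or_ge ‖x‖ 1 with h | h
  · have : (fun y => χ y - 1) =ᶠ[𝓝 x] fun _ => (0 : ℂ) := by
      filter_upwards [(isOpen_lt continuous_norm continuous_const).mem_nhds h] with y hy
      rw [hχ y (le_of_lt hy), sub_self]
    rw [this.iteratedFDeriv ℝ i |>.eq_of_nhds]
    simp only [iteratedFDeriv_fun_zero]
    simp
    positivity
  · have h1 : iteratedFDeriv ℝ i (fun y => χ y - 1) x =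
        iteratedFDeriv ℝ i χ x - iteratedFDeriv ℝ i (fun _ : E => (1 : ℂ)) x :=
      iteratedFDeriv_sub_apply ((χ.smooth i).contDiffAt) contDiffAt_const
    have h2 : ‖iteratedFDeriv ℝ i (fun _ : E => (1 : ℂ)) x‖ ≤ 1 := by
      rcases eq_or_ne i 0 with rfl | hi
      · simp
      · simp [iteratedFDeriv_const_of_ne hi]
    calc _ ≤ ‖iteratedFDeriv ℝ i χ x‖ + ‖iteratedFDeriv ℝ i (fun _ : E => (1 : ℂ)) x‖ := by
          rw [h1]; exact norm_sub_le _ _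
      _ ≤ C := add_le_add (χ.norm_iteratedFDeriv_le_seminorm ℝ i x) h2
      _ ≤ C * ‖x‖ := le_mul_of_one_le_right hC h

omit [FiniteDimensional ℝ E] in
-- In the Leibniz formula each term carries `r ‖x‖`; the extra `‖x‖` is absorbed by the seminorm of
-- `ψ` of weight `k + 1`.
theorem exists_seminorm_smulLeftCLM_sub_le {χ : 𝓢(E, ℂ)} (hχ : ∀ x, ‖x‖ ≤ 1 → χ x = 1)
    (ψ : 𝓢(E, ℂ)) (k m : ℕ) : ∃ C : ℝ, ∀ r : ℝ, 0 < r → r ≤ 1 →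
      SchwartzMap.seminorm ℝ k m
        (SchwartzMap.smulLeftCLM ℂ (fun x => χ (r • x)) ψ - ψ) ≤ C * r := by
  choose A hA0 hA using exists_norm_iteratedFDeriv_sub_one_le hχ
  set C := ∑ i ∈ Finset.range (m + 1), (m.choose i : ℝ) * A i *
    SchwartzMap.seminorm ℝ (k + 1) (m - i) ψ
  have hC : 0 ≤ C := Finset.sum_nonneg fun i _ => by have := hA0 i; positivity
  refine ⟨C, fun r hr hr1 => SchwartzMap.seminorm_le_bound _ _ _ _ (by positivity) fun x => ?_⟩
  have hg : (fun x => χ (r • x)).HasTemperateGrowth :=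
    χ.hasTemperateGrowth.comp (r • ContinuousLinearMap.id ℝ E).hasTemperateGrowth
  set η : E → ℂ := fun y => χ y - 1
  have hη : ContDiff ℝ ∞ η := (χ.smooth ⊤).sub contDiff_const
  have h1 : (⇑(SchwartzMap.smulLeftCLM ℂ (fun x => χ (r • x)) ψ - ψ) : E → ℂ) =
      fun x => η (r • x) * ψ x := by
    ext x
    simp [SchwartzMap.smulLeftCLM_apply_apply hg, η, sub_mul]
  have h2 (i : ℕ) : ‖iteratedFDeriv ℝ i (fun x => η (r • x)) x‖ ≤ A i * ‖x‖ * r := by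
    rw [iteratedFDeriv_comp_const_smul r (hη.of_le (by exact_mod_cast le_top)), norm_smul, norm_pow,
      Real.norm_of_nonneg hr.le]
    calc r ^ i * ‖iteratedFDeriv ℝ i η (r • x)‖ ≤ 1 * (A i * ‖r • x‖) := by
          gcongr
          · exact pow_le_one₀ hr.le hr1
          · exact hA i _
      _ = _ := by rw [norm_smul, Real.norm_of_nonneg hr.le]; ring
  rw [h1]
  have h3 := norm_iteratedFDeriv_mul_le (n := m) (N := ∞) (𝕜 := ℝ) (f := fun x => η (r • x)) (g := ψ)
    (hη.comp (contDiff_const_smul r)) (ψ.smooth ⊤) x (by exact_mod_cast le_top)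
  refine (mul_le_mul_of_nonneg_left h3 (by positivity)).trans ?_
  rw [Finset.mul_sum, Finset.sum_mul]
  refine Finset.sum_le_sum fun i _ => ?_
  calc ‖x‖ ^ k * (m.choose i * ‖iteratedFDeriv ℝ i (fun x => η (r • x)) x‖ *
        ‖iteratedFDeriv ℝ (m - i) ψ x‖)
      ≤ ‖x‖ ^ k * (m.choose i * (A i * ‖x‖ * r) * ‖iteratedFDeriv ℝ (m - i) ψ x‖) := by
        gcongr; exact h2 i
    _ = m.choose i * A i * (‖x‖ ^ (k + 1) * ‖iteratedFDeriv ℝ (m - i) ψ x‖) * r := by ring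
    _ ≤ _ := by
        have := hA0 i
        gcongr
        exact ψ.le_seminorm ℝ _ _ _

omit [FiniteDimensional ℝ E] in
theorem SchwartzMap.tendsto_smulLeftCLM_cutoff {χ : 𝓢(E, ℂ)} (hχ : ∀ x, ‖x‖ ≤ 1 → χ x = 1)
    (ψ : 𝓢(E, ℂ)) :
    Tendsto (fun j : ℕ => SchwartzMap.smulLeftCLM ℂ (fun x => χ ((1 / ((j : ℝ) + 1)) • x)) ψ) atTop
      (𝓝 ψ) := by
  rw [(schwartz_withSeminorms ℝ E ℂ).tendsto_nhds]
  intro ⟨k, m⟩ ε hε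
  obtain ⟨C, hC⟩ := exists_seminorm_smulLeftCLM_sub_le hχ ψ k m
  have h : Tendsto (fun j : ℕ => C * (1 / ((j : ℝ) + 1))) atTop (𝓝 0) := by
    simpa using tendsto_one_div_add_atTop_nhds_zero_nat.const_mul C
  filter_upwards [h.eventually_lt_const hε] with j hj
  refine (hC _ (by positivity) ?_).trans_lt hj
  rw [div_le_one (by positivity)]
  linarith [(Nat.cast_nonneg j : (0 : ℝ) ≤ j)]

/-- Two continuous functionals on the Schwartz space that agree on compactly supported functions
are equal. -/
theorem eq_of_forall_hasCompactSupport {S T : 𝓢(E, ℂ) → ℂ} (hS : Continuous S)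
    (hT : Continuous T) (h : ∀ ψ : 𝓢(E, ℂ), HasCompactSupport ψ → S ψ = T ψ) : S = T := by
  ext ψ
  obtain ⟨χ, hχc, hχ⟩ := exists_schwartzMap_eq_one_on_closedBall (E := E) 1
  have hlim := SchwartzMap.tendsto_smulLeftCLM_cutoff hχ ψ
  refine tendsto_nhds_unique ((hS.tendsto ψ).comp hlim) (((hT.tendsto ψ).comp hlim).congr ?_)
  intro j
  refine (h _ ?_).symm
  have hr : (1 / ((j : ℝ) + 1)) ≠ 0 := by positivity
  have hg : (fun x : E => χ ((1 / ((j : ℝ) + 1)) • x)).HasTemperateGrowth :=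
    χ.hasTemperateGrowth.comp
      ((1 / ((j : ℝ) + 1)) • ContinuousLinearMap.id ℝ E).hasTemperateGrowth
  rw [SchwartzMap.smulLeftCLM_apply hg]
  exact (hχc.comp_homeomorph (Homeomorph.smulOfNeZero _ hr)).smul_right

end Density

/-! ### Multi-index derivatives -/

section MultiIndex

variable {n : ℕ} {g : EuclideanSpace ℝ (Fin n) → ℂ}

theorem partialDeriv_eq (hg : ContDiff ℝ ∞ g) (j : Fin n) :
    partialDeriv j g = fun x => ContinuousLinearMap.apply ℝ ℂ (EuclideanSpace.single j (1 : ℝ))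
      (fderiv ℝ g x) := by
  ext x
  exact (hg.differentiable (by simp) x).lineDeriv_eq_fderiv

theorem contDiff_partialDeriv (hg : ContDiff ℝ ∞ g) (j : Fin n) :
    ContDiff ℝ ∞ (partialDeriv j g) := by
  rw [partialDeriv_eq hg]
  exact (ContinuousLinearMap.contDiff _).comp (hg.fderiv_right (by simp))

/-- A partial derivative evaluates the full derivative at a unit vector, an operation of norm at
most `1`. -/
theorem norm_iteratedFDeriv_partialDeriv_le (hg : ContDiff ℝ ∞ g) (j : Fin n) (m : ℕ)
    (x : EuclideanSpace ℝ (Fin n)) :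
    ‖iteratedFDeriv ℝ m (partialDeriv j g) x‖ ≤ ‖iteratedFDeriv ℝ (m + 1) g x‖ := by
  have h : ContDiff ℝ ∞ (fderiv ℝ g) := hg.fderiv_right (by simp)
  rw [partialDeriv_eq hg, ← norm_iteratedFDeriv_fderiv]
  refine (ContinuousLinearMap.norm_iteratedFDeriv_comp_left _ h.contDiffAt
    (by exact_mod_cast le_top)).trans (mul_le_of_le_one_left (norm_nonneg _) ?_)
  refine ContinuousLinearMap.opNorm_le_bound _ zero_le_one fun c => ?_
  simpa using c.le_opNorm (EuclideanSpace.single j (1 : ℝ))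

theorem norm_iteratedFDeriv_iterate_partialDeriv_le (j : Fin n) (a : ℕ) :
    ∀ {g : EuclideanSpace ℝ (Fin n) → ℂ}, ContDiff ℝ ∞ g → ContDiff ℝ ∞ ((partialDeriv j)^[a] g) ∧
      ∀ m x, ‖iteratedFDeriv ℝ m ((partialDeriv j)^[a] g) x‖ ≤ ‖iteratedFDeriv ℝ (m + a) g x‖ := by
  induction a with
  | zero => exact fun hg => ⟨hg, fun m x => le_rfl⟩
  | succ a ih =>
    intro g hg
    obtain ⟨h1, h2⟩ := ih (contDiff_partialDeriv hg j)
    refine ⟨h1, fun m x => (h2 m x).trans ?_⟩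
    exact norm_iteratedFDeriv_partialDeriv_le hg j (m + a) x

theorem norm_multiPartial_le (hg : ContDiff ℝ ∞ g) (α : Fin n → ℕ)
    (x : EuclideanSpace ℝ (Fin n)) :
    ‖multiPartial α g x‖ ≤ ‖iteratedFDeriv ℝ (multiLength α) g x‖ := by
  have key (l : List (Fin n)) :
      ContDiff ℝ ∞ (l.foldr (fun j g => (partialDeriv j)^[α j] g) g) ∧ ∀ m x,
        ‖iteratedFDeriv ℝ m (l.foldr (fun j g => (partialDeriv j)^[α j] g) g) x‖ ≤
          ‖iteratedFDeriv ℝ (m + (l.map α).sum) g x‖ := by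
    induction l with
    | nil => exact ⟨hg, fun m x => le_rfl⟩
    | cons j l ih =>
      obtain ⟨h1, h2⟩ := norm_iteratedFDeriv_iterate_partialDeriv_le j (α j) ih.1
      refine ⟨h1, fun m x => (h2 m x).trans ((ih.2 _ x).trans_eq ?_)⟩
      rw [List.map_cons, List.sum_cons, add_assoc]
  have := (key (List.finRange n)).2 0 x
  rwa [norm_iteratedFDeriv_zero, zero_add, ← Fin.sum_univ_def] at this

theorem norm_multiD_le (hg : ContDiff ℝ ∞ g) (α : Fin n → ℕ) (x : EuclideanSpace ℝ (Fin n)) :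
    ‖multiD α g x‖ ≤ ‖iteratedFDeriv ℝ (multiLength α) g x‖ := by
  simpa [multiD] using norm_multiPartial_le hg α x

end MultiIndex

/-! ### Modulation spaces -/

section Modulation

open FourierTransform

variable {n : ℕ} {p q : ℝ≥0∞} [hp : Fact (1 ≤ p)] {ρ : EuclideanSpace ℝ (Fin n) → ℝ} {w : ℝ → ℝ}
  {f : Lp ℂ p (volume : Measure (EuclideanSpace ℝ (Fin n)))}

/-- A single term is bounded by the `ℓ^q` norm, so every `q` reduces to the supremum bound. -/
theorem le_modNorm (hq : 1 ≤ q) (k : Fin n → ℤ) :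
    ENNReal.ofReal (Real.exp (w ‖latticePt k‖)) *
      distLpNorm p (boxOp ρ k (Lp.toTemperedDistribution f)) ≤ modNorm ρ w p q f := by
  rw [modNorm]
  split_ifs with h
  · exact le_iSup (fun k : Fin n → ℤ => ENNReal.ofReal (Real.exp (w ‖latticePt k‖)) *
      distLpNorm p (boxOp ρ k (Lp.toTemperedDistribution f))) k
  · have hq0 : 0 < q.toReal := ENNReal.toReal_pos (zero_lt_one.trans_le hq).ne' h
    rw [one_div, ENNReal.le_rpow_inv_iff hq0]
    exact ENNReal.le_tsum (f := fun k : Fin n → ℤ =>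
      (ENNReal.ofReal (Real.exp (w ‖latticePt k‖)) *
        distLpNorm p (boxOp ρ k (Lp.toTemperedDistribution f))) ^ q.toReal) k

theorem exists_toTemperedDistribution_eq_boxOp (hq : 1 ≤ q) (hf : f ∈ modSpace ρ w p q) :
    ∃ A : ℝ, 0 ≤ A ∧ ∀ k : Fin n → ℤ,
      ∃ g : Lp ℂ p (volume : Measure (EuclideanSpace ℝ (Fin n))),
        Lp.toTemperedDistribution g = boxOp ρ k (Lp.toTemperedDistribution f) ∧
          ‖g‖ ≤ A * Real.exp (-w ‖latticePt k‖) := by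
  have hf' : modNorm ρ w p q f < ⊤ := hf
  -- The `+ 1` makes the inequality strict, so that the infimum defining `distLpNorm` yields an
  -- actual representative, even when the norm is `0`.
  set A := (modNorm ρ w p q f).toReal + 1
  have hA : 0 ≤ A := by positivity
  have hlt : modNorm ρ w p q f < ENNReal.ofReal A := by
    rw [ENNReal.lt_ofReal_iff_toReal_lt hf'.ne]
    exact lt_add_one _
  refine ⟨A, hA, fun k => ?_⟩
  have h1 : distLpNorm p (boxOp ρ k (Lp.toTemperedDistribution f)) <
      ENNReal.ofReal (A * Real.exp (-w ‖latticePt k‖)) := by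
    by_contra! h
    refine hlt.not_ge (le_trans ?_ (le_modNorm hq k))
    calc ENNReal.ofReal A = ENNReal.ofReal (Real.exp (w ‖latticePt k‖)) *
          ENNReal.ofReal (A * Real.exp (-w ‖latticePt k‖)) := by
          rw [← ENNReal.ofReal_mul (Real.exp_pos _).le, mul_left_comm, ← Real.exp_add,
            add_neg_cancel, Real.exp_zero, mul_one]
      _ ≤ _ := by gcongr
  simp only [distLpNorm, iInf_lt_iff] at h1
  obtain ⟨g, hg, hlt⟩ := h1
  refine ⟨g, hg, ?_⟩
  rw [← ofReal_norm] at hlt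
  exact (ENNReal.ofReal_le_ofReal_iff (by positivity)).1 hlt.le

/-- Each piece `□ₖ f` is represented by a smooth function that satisfies Bernstein's
inequality. -/
theorem IsWindow.exists_smooth_boxOp (hρ : IsWindow ρ) (p : ℝ≥0∞) [hp : Fact (1 ≤ p)] :
    ∃ A D : ℝ, 0 ≤ A ∧ 0 ≤ D ∧ ∀ (k : Fin n → ℤ)
      (T : 𝓢'(EuclideanSpace ℝ (Fin n), ℂ))
      (g : Lp ℂ p (volume : Measure (EuclideanSpace ℝ (Fin n)))),
      Lp.toTemperedDistribution g = boxOp ρ k T →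
      ∃ u : EuclideanSpace ℝ (Fin n) → ℂ, g =ᵐ[volume] u ∧ ContDiff ℝ ∞ u ∧
        ∀ m x, ‖iteratedFDeriv ℝ m u x‖ ≤ (A * (1 + ‖latticePt k‖)) ^ m * (D * ‖g‖) := by
  obtain ⟨X, -, hX⟩ := exists_schwartzMap_eq_one_on_closedBall
    (E := EuclideanSpace ℝ (Fin n)) √n
  set K : 𝓢(EuclideanSpace ℝ (Fin n), ℂ) := 𝓕⁻ X with hK
  set A₀ := ∫ x, ‖fderiv ℝ K x‖ with hA₀
  set A₁ := ∫ x, ‖K x‖ with hA₁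
  have hA₀n : 0 ≤ A₀ := integral_nonneg fun x => norm_nonneg _
  have hA₁n : 0 ≤ A₁ := integral_nonneg fun x => norm_nonneg _
  refine ⟨A₀ + A₁, (eLpNorm K (1 - p⁻¹)⁻¹ volume).toReal, by positivity, by positivity,
    fun k T g hg => ?_⟩
  -- The translate of `X` by `a` equals `1` wherever the symbol of `□ₖ` is nonzero, so its
  -- multiplier fixes `□ₖ T`.
  set a := (2 * Real.pi)⁻¹ • latticePt k with ha
  set Y : 𝓢(EuclideanSpace ℝ (Fin n), ℂ) := X.compSubConstCLM ℂ a with hY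
  set L : 𝓢(EuclideanSpace ℝ (Fin n), ℂ) := 𝓕⁻ Y with hL
  have hLK (x) : L x = (Real.fourierChar (inner ℝ a x) : ℂ) * K x :=
    fourierInv_compSubConstCLM_apply X a x
  have hmul : boxSymbol ρ k * Y = boxSymbol ρ k := by
    ext η
    by_cases h : boxSymbol ρ k η = 0
    · simp [h]
    · have : Y η = 1 := hX _ (hρ.norm_sub_le_of_boxSymbol_ne_zero h)
      simp [this]
  have hfix : TemperedDistribution.fourierMultiplierCLM ℂ Y (Lp.toTemperedDistribution g) =
      Lp.toTemperedDistribution g := by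
    rw [hg, boxOp_eq, TemperedDistribution.fourierMultiplierCLM_fourierMultiplierCLM_apply
      (hρ.hasTemperateGrowth_boxSymbol k) Y.hasTemperateGrowth, hmul]
  have hgu := ae_eq_integral_kernel_smul_of_fourierMultiplierCLM_eq hfix
  set u := fun x => ∫ y, L (x - y) • g y with hu
  have hgu : g =ᵐ[volume] u := hgu
  -- The integral does not see null sets, so the identity holds at every `x` for this
  -- representative.
  have hrep (x) : u x = ∫ y, L (x - y) • u y := by
    refine integral_congr_ae ?_
    filter_upwards [hgu] with y hy
    rw [hy]
  have hbd (x) : ‖u x‖ ≤ (eLpNorm K (1 - p⁻¹)⁻¹ volume).toReal * ‖g‖ := by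
    rw [← eLpNorm_eq_of_modulation hLK]
    exact norm_integral_kernel_smul_le L g x
  have hbern (m : ℕ) := contDiff_and_norm_iteratedFDeriv_le_of_reproducing L m ℂ u _
    (aestronglyMeasurable_integral_kernel_smul L g) hbd hrep
  refine ⟨u, hgu, contDiff_infty.2 fun m => (hbern m).1, fun m x => ((hbern m).2 x).trans ?_⟩
  have hder : ∫ x, ‖fderiv ℝ L x‖ ≤ (A₀ + A₁) * (1 + ‖latticePt k‖) := by
    refine (integral_norm_fderiv_le_of_modulation hLK).trans ?_
    have : 2 * Real.pi * ‖a‖ = ‖latticePt k‖ := by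
      have hpi : 0 < 2 * Real.pi := by positivity
      rw [ha, norm_smul, norm_inv, Real.norm_of_nonneg hpi.le, mul_inv_cancel_left₀ hpi.ne']
    rw [this]
    nlinarith [norm_nonneg (latticePt k), mul_nonneg hA₀n (norm_nonneg (latticePt k))]
  gcongr

/-- An `Lᵖ` function is the sum of its pieces, if these are summable in the supremum norm. -/
theorem IsWindow.ae_eq_tsum (hρ : IsWindow ρ)
    {g : (Fin n → ℤ) → Lp ℂ p (volume : Measure (EuclideanSpace ℝ (Fin n)))}
    (hg : ∀ k, Lp.toTemperedDistribution (g k) = boxOp ρ k (Lp.toTemperedDistribution f))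
    {u : (Fin n → ℤ) → EuclideanSpace ℝ (Fin n) → ℂ} (hgu : ∀ k, g k =ᵐ[volume] u k)
    {v : (Fin n → ℤ) → ℝ} (hv : Summable v) (huv : ∀ k x, ‖u k x‖ ≤ v k)
    (hG : (fun x => ∑' k, u k x).HasTemperateGrowth) :
    f =ᵐ[volume] fun x => ∑' k, u k x := by
  have hu_meas (k) : AEStronglyMeasurable (u k) volume :=
    (Lp.aestronglyMeasurable (g k)).congr (hgu k)
  have hpiece (k) (φ : 𝓢(EuclideanSpace ℝ (Fin n), ℂ)) :
      ∫ x, φ x • u k x = boxOp ρ k (Lp.toTemperedDistribution f) φ := by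
    rw [← hg k, Lp.toTemperedDistribution_apply]
    refine integral_congr_ae ?_
    filter_upwards [hgu k] with x hx
    rw [hx]
  have htsum (φ : 𝓢(EuclideanSpace ℝ (Fin n), ℂ)) :
      ∫ x, φ x • ∑' k, u k x = ∑' k, boxOp ρ k (Lp.toTemperedDistribution f) φ := by
    have hint (k) : Integrable fun x => φ x • u k x :=
      φ.integrable.smul_bdd (v k) (hu_meas k) (.of_forall (huv k))
    have hsum : Summable fun k => ∫ x, ‖φ x • u k x‖ := by
      refine Summable.of_nonneg_of_le (fun k => by positivity) (fun k => ?_)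
        (hv.mul_left (∫ x, ‖φ x‖))
      rw [← integral_mul_const]
      refine integral_mono (hint k).norm (φ.integrable.norm.mul_const _) fun x => ?_
      simp only [norm_smul]
      gcongr
      exact huv k x
    rw [← tsum_congr fun k => hpiece k φ,
      integral_tsum_of_summable_integral_norm hint hsum]
    simp_rw [← tsum_const_smul'']
  set TG := Function.HasTemperateGrowth.toTemperedDistribution (volume) hG
  have hTG (φ : 𝓢(EuclideanSpace ℝ (Fin n), ℂ)) : TG φ = ∫ x, φ x • ∑' k, u k x := rfl
  -- Testing against `𝓕 ψ` with `ψ` compactly supported makes the sum over `k` finite, and the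
  -- symbols sum to `1` on the support of `ψ`.
  have key : (fun ψ : 𝓢(EuclideanSpace ℝ (Fin n), ℂ) => Lp.toTemperedDistribution f (𝓕 ψ)) =
      fun ψ => TG (𝓕 ψ) := by
    refine eq_of_forall_hasCompactSupport ?_ ?_ fun ψ hψ => ?_
    · exact (Lp.toTemperedDistribution f).continuous.comp
        (fourierCLM ℂ 𝓢(EuclideanSpace ℝ (Fin n), ℂ)).continuous
    · exact TG.continuous.comp (fourierCLM ℂ 𝓢(EuclideanSpace ℝ (Fin n), ℂ)).continuous
    · obtain ⟨s, hs1, hs2⟩ := hρ.exists_finset_smulLeftCLM hψ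
      have hbox (k) : boxOp ρ k (Lp.toTemperedDistribution f) (𝓕 ψ) =
          Lp.toTemperedDistribution f (𝓕 (SchwartzMap.smulLeftCLM ℂ (boxSymbol ρ k) ψ)) := by
        rw [boxOp_eq, TemperedDistribution.fourierMultiplierCLM_apply_apply,
          FourierTransform.fourierInv_fourier_eq]
      have h1 : TG (𝓕 ψ) = ∑' k, boxOp ρ k (Lp.toTemperedDistribution f) (𝓕 ψ) :=
        (hTG _).trans (htsum _)
      rw [h1, _root_.tsum_eq_sum (s := s)]
      · simp_rw [hbox]
        conv_lhs => rw [← hs1]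
        rw [← fourierCLM_apply (R := ℂ), map_sum, map_sum]
        rfl
      · intro k hk
        rw [hbox, hs2 k hk, ← fourierCLM_apply (R := ℂ), map_zero, map_zero]
  refine ae_eq_of_integral_contDiff_smul_eq ((Lp.memLp f).locallyIntegrable hp.out)
    hG.1.continuous.locallyIntegrable fun φ hφ hφc => ?_
  have h1 : HasCompactSupport (Complex.ofRealCLM ∘ φ) := hφc.comp_left rfl
  have h2 : ContDiff ℝ ∞ (Complex.ofRealCLM ∘ φ) := by fun_prop
  have h3 := congrFun key (𝓕⁻ (h1.toSchwartzMap h2))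
  simp only [FourierTransform.fourier_fourierInv_eq] at h3
  rw [Lp.toTemperedDistribution_apply, hTG] at h3
  simpa using h3

end Modulation

theorem mainTheorem10 {n : ℕ} (p q : ℝ≥0∞) [Fact (1 ≤ p)] (hq : 1 ≤ q)
    (ρ : EuclideanSpace ℝ (Fin n) → ℝ) (hρ : IsWindow ρ)
    (w : ℝ → ℝ) (hw : IsAdmissibleWeight w)
    (a : ℝ) (ha0 : 0 < a) (ha1 : a < 1) (hwa : IsRegularlyVarying w a)
    (f : Lp ℂ p (volume : Measure (EuclideanSpace ℝ (Fin n)))) (hf : f ∈ modSpace ρ w p q) :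
    (∀ m : ℕ, BddAbove (Set.range fun r : Ioi (0 : ℝ) => (r : ℝ) ^ m / Real.exp (w r))) ∧
    ∃ g : EuclideanSpace ℝ (Fin n) → ℂ,
      f =ᵐ[volume] g ∧ ContDiff ℝ ∞ g ∧
      (∃ C : ℝ, 0 < C ∧ ∀ (α : Fin n → ℕ) (x : EuclideanSpace ℝ (Fin n)),
        ‖multiD α g x‖ ≤ C ^ (multiLength α + 1) * assocSeq w (multiLength α)) ∧
      g ∈ carlemanClass n (assocSeq w) := by
  refine ⟨hw.bddAbove_range, ?_⟩
  obtain ⟨B, hB, hbox⟩ := exists_toTemperedDistribution_eq_boxOp hq hf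
  choose g hg hgB using hbox
  obtain ⟨A, D, hA, hD, hsmooth⟩ := hρ.exists_smooth_boxOp p
  choose u hgu hu hbern using fun k => hsmooth k _ (g k) (hg k)
  obtain ⟨C, hC, hCw⟩ := hw.exists_pow_mul_exp_neg_le ha0 hwa
  set v : ℕ → (Fin n → ℤ) → ℝ := fun m k =>
    A ^ m * (D * B) * (C ^ (m + 1) * assocSeq w m) * Real.exp (-(w ‖latticePt k‖ / 2)) with hv
  have hvsum (m : ℕ) : Summable (v m) := hw.summable_exp_neg_half.mul_left _
  have huv (m : ℕ) (k) (x : EuclideanSpace ℝ (Fin n)) : ‖iteratedFDeriv ℝ m (u k) x‖ ≤ v m k := by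
    refine (hbern k m x).trans ?_
    calc (A * (1 + ‖latticePt k‖)) ^ m * (D * ‖g k‖)
        ≤ (A * (1 + ‖latticePt k‖)) ^ m * (D * (B * Real.exp (-w ‖latticePt k‖))) := by
          gcongr; exact hgB k
      _ = A ^ m * (D * B) * ((1 + ‖latticePt k‖) ^ m * Real.exp (-w ‖latticePt k‖)) := by
          rw [mul_pow]; ring
      _ ≤ A ^ m * (D * B) *
          (C ^ (m + 1) * assocSeq w m * Real.exp (-(w ‖latticePt k‖ / 2))) := by
          exact mul_le_mul_of_nonneg_left (hCw ‖latticePt k‖ (norm_nonneg _) m) (by positivity)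
      _ = v m k := by rw [hv]; ring
  have hG : ContDiff ℝ ∞ fun x => ∑' k, u k x :=
    contDiff_tsum hu (fun m _ => hvsum m) fun m k x _ => huv m k x
  set S := ∑' k : Fin n → ℤ, Real.exp (-(w ‖latticePt k‖ / 2)) with hS
  have hS0 : 0 ≤ S := tsum_nonneg fun k => (Real.exp_pos _).le
  have hGbd (m : ℕ) (x : EuclideanSpace ℝ (Fin n)) : ‖iteratedFDeriv ℝ m (fun x => ∑' k, u k x) x‖ ≤
      A ^ m * (D * B) * (C ^ (m + 1) * assocSeq w m) * S := by
    rw [iteratedFDeriv_tsum_apply hu (fun m _ => hvsum m) (fun m k x _ => huv m k x)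
      (by exact_mod_cast le_top : (m : ℕ∞) ≤ ⊤), hS, ← tsum_mul_left]
    exact tsum_of_norm_bounded (hvsum m).hasSum fun k => huv m k x
  -- Both `A + 1` and `D * B * S + 1` are at least `1`, so their powers of order `m + 1` absorb `A ^
  -- m` and `D * B * S`.
  set C' := (A + 1) * C * (D * B * S + 1) with hC'
  have hC'0 : 0 < C' := by positivity
  have hbound (α : Fin n → ℕ) (x : EuclideanSpace ℝ (Fin n)) : ‖multiD α (fun x => ∑' k, u k x) x‖ ≤
      C' ^ (multiLength α + 1) * assocSeq w (multiLength α) := by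
    refine (norm_multiD_le hG α x).trans ((hGbd _ x).trans ?_)
    set m := multiLength α
    have hM := hw.assocSeq_pos m
    have h1 : A ^ m ≤ (A + 1) ^ (m + 1) :=
      (pow_le_pow_left₀ hA (by linarith) m).trans (pow_le_pow_right₀ (by linarith) (Nat.le_succ m))
    have h2 : D * B * S ≤ (D * B * S + 1) ^ (m + 1) :=
      (by linarith : D * B * S ≤ D * B * S + 1).trans
        (le_self_pow₀ (le_add_of_nonneg_left (by positivity)) (Nat.succ_ne_zero m))
    calc A ^ m * (D * B) * (C ^ (m + 1) * assocSeq w m) * S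
        = A ^ m * C ^ (m + 1) * (D * B * S) * assocSeq w m := by ring
      _ ≤ (A + 1) ^ (m + 1) * C ^ (m + 1) * (D * B * S + 1) ^ (m + 1) * assocSeq w m := by
          gcongr
      _ = C' ^ (m + 1) * assocSeq w m := by rw [hC', mul_pow, mul_pow]
  -- The global bound serves every compact set, with `h = C'` and one further factor `C'` as the
  -- constant.
  refine ⟨fun x => ∑' k, u k x, ?_, hG, ⟨C', hC'0, hbound⟩, hG, fun _ _ =>
    ⟨C', hC'0, C', fun x _ α => (hbound α x).trans_eq (by rw [pow_succ]; ring)⟩⟩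
  refine hρ.ae_eq_tsum hg hgu (hvsum 0) (fun k x => by simpa using huv 0 k x) ⟨hG, fun m => ?_⟩
  exact ⟨0, _, fun x => by simpa using hGbd m x⟩
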